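/- Let $m\ge 2$ and $n\ge 1$ be integers. Let $S^m\subset\mathbb R^{m+1}$ be the unit sphere with its uniform (normalised surface) probability measure, and equip $(S^m)^n$ with the product probability measure. For $i\in\{1,2\}$ let $h_i(z)=z_i$ be the $i$-th coordinate of $z=(z_1,\dots,z_{m+1})\in S^m$, let $\mathcal H_i=\sigma(h_i(x_1),\dots,h_i(x_n))$ be the $\sigma$-algebra on $(S^m)^n$ generated by the $i$-th coordinates of the $n$ points of $x=(x_1,\dots,x_n)$, and let $E_if=\mathbb E[f\mid\mathcal H_i]$ be the corresponding conditional expectation operator on the complex space $L^2((S^m)^n)$. Then for every $f\in L^2((S^m)^n)$ with $\int f=0$, \[ \|E_2E_1f\|_2\le \frac1m\,\|f\|_2 . \] -/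

import Mathlib

open MeasureTheory
open scoped ENNReal

/-- The unit sphere `S^m` in `ℝ^(m+1)`. -/
abbrev UnitSphere (m : ℕ) : Type :=
  Metric.sphere (0 : EuclideanSpace ℝ (Fin (m + 1))) 1

/-- The uniform (normalised surface) probability measure on `S^m`. -/
noncomputable def sphereUniform (m : ℕ) : Measure (UnitSphere m) :=
  ((volume : Measure (EuclideanSpace ℝ (Fin (m + 1)))).toSphere Set.univ)⁻¹ •
    (volume : Measure (EuclideanSpace ℝ (Fin (m + 1)))).toSphere

instance sphereUniform_isProbabilityMeasure (m : ℕ) :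
    IsProbabilityMeasure (sphereUniform m) := by
  have : NeZero (volume : Measure (EuclideanSpace ℝ (Fin (m + 1)))).toSphere :=
    ⟨Measure.toSphere_ne_zero _⟩
  unfold sphereUniform
  infer_instance

/-- The product probability measure on `(S^m)^n`: `n` independent uniform points. -/
noncomputable def spherePowUniform (m n : ℕ) : Measure (Fin n → UnitSphere m) :=
  Measure.pi fun _ => sphereUniform m

instance spherePowUniform_isProbabilityMeasure (m n : ℕ) :
    IsProbabilityMeasure (spherePowUniform m n) := by
  unfold spherePowUniform
  infer_instance

/-- The vector of the `i`-th coordinates (heights) of the `n` points (`i` counted from `0`). -/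
def heights (m n : ℕ) (i : Fin (m + 1)) (x : Fin n → UnitSphere m) : Fin n → ℝ :=
  fun j => (x j : EuclideanSpace ℝ (Fin (m + 1))) i

theorem measurable_heights (m n : ℕ) (i : Fin (m + 1)) : Measurable (heights m n i) := by
  unfold heights
  fun_prop

/-- The σ-algebra on `(S^m)^n` generated by the `i`-th heights of the `n` points. -/
abbrev heightSigma (m n : ℕ) (i : Fin (m + 1)) : MeasurableSpace (Fin n → UnitSphere m) :=
  MeasurableSpace.comap (heights m n i) inferInstance

theorem heightSigma_le (m n : ℕ) (i : Fin (m + 1)) :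
    heightSigma m n i ≤ (inferInstance : MeasurableSpace (Fin n → UnitSphere m)) :=
  (measurable_heights m n i).comap_le

/-- Conditional expectation of `f` given the `i`-th heights of the `n` points. -/
noncomputable def heightCondExp (m n : ℕ) (i : Fin (m + 1))
    (f : (Fin n → UnitSphere m) → ℂ) : (Fin n → UnitSphere m) → ℂ :=
  condExp (heightSigma m n i) (spherePowUniform m n) f

/-! Write g for the first conditional expectation of f and h for the second one applied to g. Then
‖h‖² = ⟨g, h⟩, so it suffices that mean-zero functions of the heights in one direction and functions
of the heights in another have correlation at most 1/m (`norm_inner_toLp_le`).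

For one point, given x_j, odd powers of x_i average to 0, and x_i^(2b) averages to c (1 - x_j²)^b
with |c| ≤ 1/m for b ≥ 1. So conditioning never raises the degree of a polynomial. By symmetry under
exchange of coordinates this operator is self-adjoint, and a triangular self-adjoint operator is
diagonal in the orthogonal polynomials. Its eigenvalues are the diagonal coefficients: 1 in degree
0, at most 1/m in absolute value otherwise (`exists_isCoordEigenSystem`).

For n independent points, products of these polynomials diagonalise the correlation, with products
of eigenvalues; any nonconstant product contains a factor at most 1/m. Stone–Weierstrass makes the
products total, and Cauchy–Schwarz gives the bound (`norm_inner_le_of_diagonal_correlation`). -/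

/-! ### Spherical averages through Gaussian integrals -/

/-- The radial factor relating spherical averages of functions that are homogeneous of degree `d`
to their Gaussian integrals on `ℝ^(m+1)`. -/
noncomputable def gaussianRadialFactor (m d : ℕ) : ℝ :=
  ((volume : Measure (EuclideanSpace ℝ (Fin (m + 1)))).toSphere Set.univ).toReal *
    ∫ r : Set.Ioi (0 : ℝ), (r : ℝ) ^ d * Real.exp (-(r : ℝ) ^ 2) ∂(Measure.volumeIoiPow m)

theorem integral_pow_mul_exp_neg_sq_volumeIoiPow_pos (m d : ℕ) :
    0 < ∫ r : Set.Ioi (0 : ℝ), (r : ℝ) ^ d * Real.exp (-(r : ℝ) ^ 2)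
      ∂(Measure.volumeIoiPow m) := by
  have h : ∫ r : Set.Ioi (0 : ℝ), (r : ℝ) ^ d * Real.exp (-(r : ℝ) ^ 2)
      ∂(Measure.volumeIoiPow m) =
      ∫ y in Set.Ioi (0 : ℝ), y ^ ((m + d : ℕ) : ℝ) * Real.exp (-y ^ (2 : ℝ)) := by
    simp only [Measure.volumeIoiPow, ENNReal.ofReal]
    rw [integral_withDensity_eq_integral_smul,
      integral_subtype_comap measurableSet_Ioi
        fun a : ℝ ↦ Real.toNNReal (a ^ m) • (a ^ d * Real.exp (-a ^ 2)),
      setIntegral_congr_fun measurableSet_Ioi fun x hx ↦ ?_]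
    · simp only [NNReal.smul_def]
      rw [Real.coe_toNNReal _ (pow_nonneg (Set.mem_Ioi.1 hx).le _), Real.rpow_natCast, pow_add,
        smul_eq_mul, mul_assoc]
      norm_num
    · exact (measurable_subtype_coe.pow_const _).real_toNNReal
  rw [h, integral_rpow_mul_exp_neg_rpow (by norm_num) (by have := (m + d).cast_nonneg (α := ℝ); linarith)]
  have := (m + d).cast_nonneg (α := ℝ)
  have : 0 < Real.Gamma ((((m + d : ℕ) : ℝ) + 1) / 2) := Real.Gamma_pos_of_pos (by positivity)
  positivity

theorem gaussianRadialFactor_pos (m d : ℕ) : 0 < gaussianRadialFactor m d := by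
  refine mul_pos (ENNReal.toReal_pos ?_ (measure_ne_top _ _))
    (integral_pow_mul_exp_neg_sq_volumeIoiPow_pos m d)
  simp only [ne_eq, Measure.measure_univ_eq_zero]
  exact Measure.toSphere_ne_zero _

/-- Polar coordinates: homogeneity separates the radius from the direction. -/
theorem integral_sphereUniform_mul_radialFactor (m d : ℕ)
    (F : EuclideanSpace ℝ (Fin (m + 1)) → ℝ)
    (hF : ∀ r : ℝ, 0 < r → ∀ x, F (r • x) = r ^ d * F x) :
    (∫ x, F x ∂(sphereUniform m)) * gaussianRadialFactor m d =
      ∫ x, F x * Real.exp (-‖x‖ ^ 2) := by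
  have hdim : Module.finrank ℝ (EuclideanSpace ℝ (Fin (m + 1))) - 1 = m := by simp
  have h1 : ∫ x, F x * Real.exp (-‖x‖ ^ 2) =
      (∫ x : UnitSphere m, F x ∂(volume : Measure (EuclideanSpace ℝ (Fin (m + 1)))).toSphere) *
      ∫ r : Set.Ioi (0 : ℝ), (r : ℝ) ^ d * Real.exp (-(r : ℝ) ^ 2) ∂(Measure.volumeIoiPow m) := by
    have hcone : ∫ x, F x * Real.exp (-‖x‖ ^ 2) =
        ∫ x : ({0}ᶜ : Set (EuclideanSpace ℝ (Fin (m + 1)))), F x.1 * Real.exp (-‖x.1‖ ^ 2)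
          ∂(volume.comap Subtype.val) := by
      rw [integral_subtype_comap (measurableSet_singleton _).compl
        fun x ↦ F x * Real.exp (-‖x‖ ^ 2), restrict_compl_singleton]
    rw [← integral_prod_mul, hcone]
    have := (volume : Measure (EuclideanSpace ℝ
      (Fin (m + 1)))).measurePreserving_homeomorphUnitSphereProd.integral_comp
        (Homeomorph.measurableEmbedding _)
        (fun z ↦ F z.1 * ((z.2 : ℝ) ^ d * Real.exp (-(z.2 : ℝ) ^ 2)))
    rw [hdim] at this
    rw [← this]
    refine integral_congr_ae (.of_forall fun x ↦ ?_)
    have hx : 0 < ‖(x : EuclideanSpace ℝ (Fin (m + 1)))‖ := norm_pos_iff.2 x.2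
    have h2 := hF _ hx (‖(x : EuclideanSpace ℝ (Fin (m + 1)))‖⁻¹ • (x : EuclideanSpace ℝ (Fin (m + 1))))
    rw [smul_inv_smul₀ hx.ne'] at h2
    simp only [homeomorphUnitSphereProd_apply_fst_coe, homeomorphUnitSphereProd_apply_snd_coe]
    rw [h2]; ring
  have h0 : ((volume : Measure (EuclideanSpace ℝ (Fin (m + 1)))).toSphere Set.univ).toReal ≠ 0 := by
    refine (ENNReal.toReal_pos ?_ (measure_ne_top _ _)).ne'
    simp only [ne_eq, Measure.measure_univ_eq_zero]
    exact Measure.toSphere_ne_zero _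
  rw [h1, sphereUniform, integral_smul_measure, gaussianRadialFactor, ENNReal.toReal_inv,
    smul_eq_mul]
  field_simp

/-- Lebesgue measure and the Gaussian weight are both invariant under linear isometries, and the
positive radial factor cancels. -/
theorem integral_sphereUniform_comp_isometry (m d : ℕ)
    (e : EuclideanSpace ℝ (Fin (m + 1)) ≃ₗᵢ[ℝ] EuclideanSpace ℝ (Fin (m + 1)))
    (F : EuclideanSpace ℝ (Fin (m + 1)) → ℝ)
    (hF : ∀ r : ℝ, 0 < r → ∀ x, F (r • x) = r ^ d * F x) :
    ∫ x : UnitSphere m, F (e x) ∂(sphereUniform m) = ∫ x : UnitSphere m, F x ∂(sphereUniform m) := by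
  refine mul_right_cancel₀ (gaussianRadialFactor_pos m d).ne' ?_
  rw [integral_sphereUniform_mul_radialFactor m d (fun x ↦ F (e x))
    (fun r hr x ↦ by rw [map_smul, hF r hr]), integral_sphereUniform_mul_radialFactor m d F hF,
    ← e.measurePreserving.integral_comp e.toHomeomorph.measurableEmbedding
      (fun x ↦ F x * Real.exp (-‖x‖ ^ 2))]
  simp

theorem integral_gaussian_split (m : ℕ) (j : Fin (m + 1)) (f : ℝ → ℝ) (h : (Fin m → ℝ) → ℝ) :
    ∫ x : EuclideanSpace ℝ (Fin (m + 1)),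
      (f (x j) * h (fun i ↦ x (j.succAbove i))) * Real.exp (-‖x‖ ^ 2) =
    (∫ t, f t * Real.exp (-t ^ 2)) * ∫ y : Fin m → ℝ, h y * Real.exp (-∑ i, y i ^ 2) := by
  rw [← integral_prod_mul, ← Measure.volume_eq_prod,
    ← (volume_preserving_piFinSuccAbove (fun _ ↦ ℝ) j).integral_comp
      (MeasurableEquiv.measurableEmbedding _),
    ← (EuclideanSpace.volume_preserving_symm_measurableEquiv_toLp
      (Fin (m + 1))).integral_comp (MeasurableEquiv.measurableEmbedding _)]
  refine integral_congr_ae (.of_forall fun x ↦ ?_)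
  have : -‖x‖ ^ 2 = -(x j) ^ 2 + -∑ i, x (j.succAbove i) ^ 2 := by
    rw [EuclideanSpace.real_norm_sq_eq, Fin.sum_univ_succAbove _ j]; ring
  simp only [this, Real.exp_add]
  simp [MeasurableEquiv.piFinSuccAbove, Fin.insertNthEquiv]
  rw [show j.removeNth x.ofLp = fun i ↦ x (j.succAbove i) from rfl]
  ring

/-- Under the Gaussian weight x_j is independent of the other coordinates, so the exponent `l` and
the function `h` end up in separate factors. This replaces conditioning on x_j. -/
theorem integral_sphereUniform_split (m l k : ℕ) (j : Fin (m + 1)) (h : (Fin m → ℝ) → ℝ)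
    (hh : ∀ r : ℝ, 0 < r → ∀ y, h (r • y) = r ^ k * h y) :
    (∫ x : UnitSphere m, (x : EuclideanSpace ℝ (Fin (m + 1))) j ^ l *
        h (fun i ↦ (x : EuclideanSpace ℝ (Fin (m + 1))) (j.succAbove i)) ∂(sphereUniform m)) *
      gaussianRadialFactor m (l + k) =
    (∫ t : ℝ, t ^ l * Real.exp (-t ^ 2)) * ∫ y : Fin m → ℝ, h y * Real.exp (-∑ i, y i ^ 2) := by
  rw [integral_sphereUniform_mul_radialFactor m (l + k)
    (fun x ↦ x j ^ l * h (fun i ↦ x (j.succAbove i))), ← integral_gaussian_split m j (· ^ l) h]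
  intro r hr x
  have := hh r hr (fun i ↦ x (j.succAbove i))
  simp only [PiLp.smul_apply, smul_eq_mul]
  rw [show (fun i ↦ r * x (j.succAbove i)) = r • (fun i ↦ x (j.succAbove i)) from rfl, this]
  ring

/-! ### Joint moments of two coordinates of one point -/

theorem integrable_sphereUniform_of_continuous {m : ℕ} {F : UnitSphere m → ℝ}
    (hF : Continuous F) : Integrable F (sphereUniform m) :=
  hF.integrable_of_hasCompactSupport (.of_compactSpace _)

theorem UnitSphere.sum_erase_sq {m : ℕ} (x : UnitSphere m) (j : Fin (m + 1)) :
    ∑ i ∈ Finset.univ.erase j, (x : EuclideanSpace ℝ (Fin (m + 1))) i ^ 2 =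
      1 - (x : EuclideanSpace ℝ (Fin (m + 1))) j ^ 2 := by
  have h1 : ∑ i, (x : EuclideanSpace ℝ (Fin (m + 1))) i ^ 2 = 1 := by
    rw [← EuclideanSpace.real_norm_sq_eq, norm_eq_of_mem_sphere x, one_pow]
  rw [← Finset.add_sum_erase _ _ (Finset.mem_univ j)] at h1
  linarith

theorem UnitSphere.sq_le_one_sub_sq {m : ℕ} (x : UnitSphere m) {i j : Fin (m + 1)} (hij : i ≠ j) :
    (x : EuclideanSpace ℝ (Fin (m + 1))) i ^ 2 ≤ 1 - (x : EuclideanSpace ℝ (Fin (m + 1))) j ^ 2 := by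
  rw [← x.sum_erase_sq j]
  exact Finset.single_le_sum (f := fun i ↦ (x : EuclideanSpace ℝ (Fin (m + 1))) i ^ 2)
    (fun i _ ↦ sq_nonneg _) (Finset.mem_erase.2 ⟨hij, Finset.mem_univ _⟩)

/-- The m coordinates other than x_j are exchangeable, and their squares sum to 1 - x_j². This is
the source of the constant 1/m. -/
theorem integral_sphereUniform_sq_mul_pow (m a : ℕ) {i j : Fin (m + 1)} (hij : i ≠ j) :
    (m : ℝ) * ∫ x : UnitSphere m, (x : EuclideanSpace ℝ (Fin (m + 1))) i ^ 2 *
        (1 - (x : EuclideanSpace ℝ (Fin (m + 1))) j ^ 2) ^ a ∂(sphereUniform m) =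
      ∫ x : UnitSphere m, (1 - (x : EuclideanSpace ℝ (Fin (m + 1))) j ^ 2) ^ (a + 1)
        ∂(sphereUniform m) := by
  have key : ∀ i' ∈ Finset.univ.erase j,
      ∫ x : UnitSphere m, (x : EuclideanSpace ℝ (Fin (m + 1))) i' ^ 2 *
        (1 - (x : EuclideanSpace ℝ (Fin (m + 1))) j ^ 2) ^ a ∂(sphereUniform m) =
      ∫ x : UnitSphere m, (x : EuclideanSpace ℝ (Fin (m + 1))) i ^ 2 *
        (1 - (x : EuclideanSpace ℝ (Fin (m + 1))) j ^ 2) ^ a ∂(sphereUniform m) := by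
    intro i' hi'
    have hi' : i' ≠ j := (Finset.mem_erase.1 hi').1
    -- On the sphere 1 equals ‖x‖², which makes the integrand homogeneous.
    have := integral_sphereUniform_comp_isometry m (2 + 2 * a)
      (LinearIsometryEquiv.piLpCongrLeft 2 ℝ ℝ (Equiv.swap i i'))
      (fun x ↦ x i ^ 2 * (‖x‖ ^ 2 - x j ^ 2) ^ a) (fun r hr x ↦ by
        have : (‖r • x‖ ^ 2 - (r * x j) ^ 2) = r ^ 2 * (‖x‖ ^ 2 - x j ^ 2) := by
          rw [norm_smul, Real.norm_of_nonneg hr.le]; ring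
        simp only [PiLp.smul_apply, smul_eq_mul, this]
        rw [mul_pow, mul_pow, pow_add, pow_mul]; ring)
    simp only [LinearIsometryEquiv.norm_map, norm_eq_of_mem_sphere, one_pow] at this
    rw [← this]
    refine integral_congr_ae (.of_forall fun x ↦ ?_)
    simp [LinearIsometryEquiv.piLpCongrLeft_apply, Equiv.piCongrLeft'_apply,
      Equiv.swap_apply_of_ne_of_ne hij.symm hi'.symm]
  have hint : ∀ i' : Fin (m + 1), Integrable (fun x : UnitSphere m ↦
      (x : EuclideanSpace ℝ (Fin (m + 1))) i' ^ 2 *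
        (1 - (x : EuclideanSpace ℝ (Fin (m + 1))) j ^ 2) ^ a) (sphereUniform m) := fun i' ↦
    integrable_sphereUniform_of_continuous (by fun_prop)
  calc _ = ∑ i' ∈ Finset.univ.erase j,
        ∫ x : UnitSphere m, (x : EuclideanSpace ℝ (Fin (m + 1))) i' ^ 2 *
        (1 - (x : EuclideanSpace ℝ (Fin (m + 1))) j ^ 2) ^ a ∂(sphereUniform m) := by
        rw [Finset.sum_congr rfl key]
        simp
    _ = _ := by
        rw [← integral_finsetSum _ fun i' _ ↦ hint i']
        refine integral_congr_ae (.of_forall fun x ↦ ?_)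
        simp only
        rw [← Finset.sum_mul, x.sum_erase_sq, pow_succ _ a, mul_comm]

/-- All but one of the factors x_i² are bounded by 1 - x_j²; the remaining one is averaged exactly.
-/
theorem integral_sphereUniform_pow_le (m a : ℕ) (hm : 0 < m) {i j : Fin (m + 1)} (hij : i ≠ j) :
    ∫ x : UnitSphere m, (x : EuclideanSpace ℝ (Fin (m + 1))) i ^ (2 * (a + 1))
        ∂(sphereUniform m) ≤
      1 / (m : ℝ) * ∫ x : UnitSphere m,
        (1 - (x : EuclideanSpace ℝ (Fin (m + 1))) j ^ 2) ^ (a + 1) ∂(sphereUniform m) := by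
  rw [← integral_sphereUniform_sq_mul_pow m a hij, ← mul_assoc,
    one_div_mul_cancel (by positivity), one_mul]
  refine integral_mono (integrable_sphereUniform_of_continuous (by fun_prop))
    (integrable_sphereUniform_of_continuous (by fun_prop)) fun x ↦ ?_
  simp only
  rw [pow_mul, pow_succ, mul_comm]
  gcongr
  exact x.sq_le_one_sub_sq hij

/-- The conditional moments of one coordinate given another, odd case. -/
theorem integral_sphereUniform_odd_pow_mul (m a l : ℕ) {i j : Fin (m + 1)} (hij : i ≠ j) :
    ∫ x : UnitSphere m, (x : EuclideanSpace ℝ (Fin (m + 1))) i ^ (2 * a + 1) *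
      (x : EuclideanSpace ℝ (Fin (m + 1))) j ^ l ∂(sphereUniform m) = 0 := by
  obtain ⟨i, rfl⟩ := Fin.exists_succAbove_eq hij
  have h := integral_sphereUniform_split m l (2 * a + 1) j (fun y ↦ y i ^ (2 * a + 1))
    (fun r _ y ↦ by simp [mul_pow])
  -- The integrand is odd under y ↦ -y.
  have h0 : ∫ y : Fin m → ℝ, y i ^ (2 * a + 1) * Real.exp (-∑ i, y i ^ 2) = 0 := by
    have := integral_neg_eq_self
      (fun y : Fin m → ℝ ↦ y i ^ (2 * a + 1) * Real.exp (-∑ i, y i ^ 2)) volume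
    simp only [Pi.neg_apply, neg_sq, Odd.neg_pow ⟨a, rfl⟩, neg_mul, integral_neg] at this
    linarith
  rw [h0, mul_zero] at h
  simpa [mul_comm] using (mul_eq_zero.1 h).resolve_right (gaussianRadialFactor_pos _ _).ne'

/-- The conditional moments of one coordinate given another, even case. -/
theorem exists_integral_sphereUniform_even_pow_mul (m a : ℕ) (hm : 0 < m) {i j : Fin (m + 1)}
    (hij : i ≠ j) :
    ∃ c : ℝ, |c| ≤ 1 / (m : ℝ) ∧ ∀ l : ℕ,
      ∫ x : UnitSphere m, (x : EuclideanSpace ℝ (Fin (m + 1))) i ^ (2 * (a + 1)) *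
        (x : EuclideanSpace ℝ (Fin (m + 1))) j ^ l ∂(sphereUniform m) =
      c * ∫ x : UnitSphere m, (1 - (x : EuclideanSpace ℝ (Fin (m + 1))) j ^ 2) ^ (a + 1) *
        (x : EuclideanSpace ℝ (Fin (m + 1))) j ^ l ∂(sphereUniform m) := by
  have hle := integral_sphereUniform_pow_le m a hm hij
  obtain ⟨i, rfl⟩ := Fin.exists_succAbove_eq hij
  have h1 := fun l ↦ integral_sphereUniform_split m l (2 * (a + 1)) j
    (fun y ↦ y i ^ (2 * (a + 1))) (fun r _ y ↦ by simp [mul_pow])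
  have h2 := fun l ↦ integral_sphereUniform_split m l (2 * (a + 1)) j
    (fun y ↦ (∑ i, y i ^ 2) ^ (a + 1)) (fun r _ y ↦ by
      simp only [Pi.smul_apply, smul_eq_mul, mul_pow, ← Finset.mul_sum, ← pow_mul])
  have hs : ∀ x : UnitSphere m, ∑ i, (x : EuclideanSpace ℝ (Fin (m + 1))) (j.succAbove i) ^ 2 =
      1 - (x : EuclideanSpace ℝ (Fin (m + 1))) j ^ 2 := by
    intro x
    rw [← x.sum_erase_sq j, ← add_right_inj ((x : EuclideanSpace ℝ (Fin (m + 1))) j ^ 2),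
      Finset.add_sum_erase _ (fun i ↦ (x : EuclideanSpace ℝ (Fin (m + 1))) i ^ 2)
        (Finset.mem_univ j), Fin.sum_univ_succAbove _ j]
  simp only [hs] at h2
  set H1 : ℝ := ∫ y : Fin m → ℝ, y i ^ (2 * (a + 1)) * Real.exp (-∑ i, y i ^ 2)
  set H2 : ℝ := ∫ y : Fin m → ℝ, (∑ i, y i ^ 2) ^ (a + 1) * Real.exp (-∑ i, y i ^ 2)
  have hA : 0 < ∫ t : ℝ, t ^ 0 * Real.exp (-t ^ 2) := by
    have := integral_gaussian 1
    simp only [neg_mul, one_mul, div_one] at this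
    simp only [pow_zero, one_mul, this]
    positivity
  have hR := gaussianRadialFactor_pos m (0 + 2 * (a + 1))
  have hH1 : 0 ≤ H1 := integral_nonneg fun y ↦ by
    simp only [pow_mul, Pi.zero_apply]
    positivity
  -- The ratio H1 / H2 does not depend on `l`, so the case l = 0 already bounds it.
  have hH : H1 ≤ 1 / (m : ℝ) * H2 := by
    have e1 := h1 0
    have e2 := h2 0
    simp only [pow_zero, one_mul] at e1 e2 hA
    refine le_of_mul_le_mul_left ?_ hA
    rw [← e1, mul_left_comm, ← e2, ← mul_assoc]
    gcongr
  obtain ⟨c, hc, hc'⟩ : ∃ c : ℝ, |c| ≤ 1 / (m : ℝ) ∧ H1 = c * H2 := by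
    rcases eq_or_ne H2 0 with h0 | h0
    · exact ⟨0, by simp, by rw [h0] at hH; rw [h0]; linarith⟩
    · have hH2 : 0 < H2 := lt_of_le_of_ne (by
        by_contra hneg
        have : 1 / (m : ℝ) * H2 < 0 := mul_neg_of_pos_of_neg (by positivity) (not_le.1 hneg)
        linarith) h0.symm
      refine ⟨H1 / H2, ?_, by field_simp⟩
      rw [abs_of_nonneg (by positivity), div_le_iff₀ hH2]
      exact hH
  refine ⟨c, hc, fun l ↦ mul_right_cancel₀ (gaussianRadialFactor_pos m (l + 2 * (a + 1))).ne' ?_⟩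
  simp only [mul_comm _ ((_ : ℝ) ^ l)]
  rw [h1, mul_assoc, h2, hc']
  ring

theorem integral_sphereUniform_swap (m k l : ℕ) (i j : Fin (m + 1)) :
    ∫ x : UnitSphere m, (x : EuclideanSpace ℝ (Fin (m + 1))) i ^ k *
      (x : EuclideanSpace ℝ (Fin (m + 1))) j ^ l ∂(sphereUniform m) =
    ∫ x : UnitSphere m, (x : EuclideanSpace ℝ (Fin (m + 1))) j ^ k *
      (x : EuclideanSpace ℝ (Fin (m + 1))) i ^ l ∂(sphereUniform m) := by
  rw [← integral_sphereUniform_comp_isometry m (k + l)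
    (LinearIsometryEquiv.piLpCongrLeft 2 ℝ ℝ (Equiv.swap i j)) (fun x ↦ x i ^ k * x j ^ l)
    (fun r _ x ↦ by simp only [PiLp.smul_apply, smul_eq_mul]; ring)]
  simp [LinearIsometryEquiv.piLpCongrLeft_apply, Equiv.piCongrLeft'_apply]

/-! ### Orthogonal polynomials diagonalising the correlation of two coordinates -/

section OrthogonalPolynomials

open Polynomial

/-- The bilinear form `𝔼[p(x_i) q(x_j)]` for a uniform point `x` of the sphere. -/
noncomputable def coordCorr (m : ℕ) (i j : Fin (m + 1)) : ℝ[X] →ₗ[ℝ] ℝ[X] →ₗ[ℝ] ℝ :=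
  LinearMap.mk₂ ℝ (fun p q ↦ ∫ x : UnitSphere m, p.eval ((x : EuclideanSpace ℝ (Fin (m + 1))) i) *
      q.eval ((x : EuclideanSpace ℝ (Fin (m + 1))) j) ∂(sphereUniform m))
    (fun p p' q ↦ by
      simp only [eval_add, add_mul]
      exact integral_add (integrable_sphereUniform_of_continuous (by fun_prop))
        (integrable_sphereUniform_of_continuous (by fun_prop)))
    (fun c p q ↦ by
      simp only [eval_smul, smul_eq_mul, mul_assoc, integral_const_mul])
    (fun p q q' ↦ by
      simp only [eval_add, mul_add]
      exact integral_add (integrable_sphereUniform_of_continuous (by fun_prop))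
        (integrable_sphereUniform_of_continuous (by fun_prop)))
    (fun c p q ↦ by
      simp only [eval_smul, smul_eq_mul, mul_left_comm _ c, integral_const_mul])

theorem coordCorr_apply (m : ℕ) (i j : Fin (m + 1)) (p q : ℝ[X]) :
    coordCorr m i j p q = ∫ x : UnitSphere m, p.eval ((x : EuclideanSpace ℝ (Fin (m + 1))) i) *
      q.eval ((x : EuclideanSpace ℝ (Fin (m + 1))) j) ∂(sphereUniform m) := rfl

theorem coordCorr_comm (m : ℕ) (i j : Fin (m + 1)) (p q : ℝ[X]) :
    coordCorr m i j p q = coordCorr m j i q p := by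
  simp only [coordCorr_apply, mul_comm]

theorem Polynomial.bilin_ext_X_pow {f g : ℝ[X] →ₗ[ℝ] ℝ[X] →ₗ[ℝ] ℝ}
    (h : ∀ k l : ℕ, f (X ^ k) (X ^ l) = g (X ^ k) (X ^ l)) : f = g := by
  refine (basisMonomials ℝ).ext fun k ↦ (basisMonomials ℝ).ext fun l ↦ ?_
  simpa [monomial_one_right_eq_X_pow] using h k l

/-- Together with `coordCorr_comm` this is the self-adjointness of conditioning one coordinate on
the other. -/
theorem coordCorr_swap (m : ℕ) (i j : Fin (m + 1)) : coordCorr m i j = coordCorr m j i :=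
  Polynomial.bilin_ext_X_pow fun k l ↦ by
    simpa [coordCorr_apply] using integral_sphereUniform_swap m k l i j

theorem coordCorr_self_eq (m : ℕ) (i j : Fin (m + 1)) : coordCorr m i i = coordCorr m j j :=
  Polynomial.bilin_ext_X_pow fun k l ↦ by
    simpa [coordCorr_apply, pow_add] using integral_sphereUniform_swap m (k + l) 0 i j

theorem one_sub_X_sq_pow_sub_mem_degreeLT (a : ℕ) :
    (1 - X ^ 2 : ℝ[X]) ^ (a + 1) - C ((-1) ^ (a + 1)) * X ^ (2 * (a + 1)) ∈
      degreeLT ℝ (2 * (a + 1)) := by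
  have hP : (1 - X ^ 2 : ℝ[X]) = C (-1) * X ^ 2 + C 0 * X + C 1 := by simp; ring
  have hn : (1 - X ^ 2 : ℝ[X]).natDegree = 2 := by rw [hP]; exact natDegree_quadratic (by norm_num)
  have hl : (1 - X ^ 2 : ℝ[X]).leadingCoeff = -1 := by
    rw [hP]; exact leadingCoeff_quadratic (by norm_num)
  have hne : (1 - X ^ 2 : ℝ[X]) ≠ 0 := by
    intro h; rw [h] at hn; simp at hn
  have hd : ((1 - X ^ 2 : ℝ[X]) ^ (a + 1)).degree = ((2 * (a + 1) : ℕ) : WithBot ℕ) := by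
    rw [degree_eq_natDegree (pow_ne_zero _ hne), natDegree_pow, hn, mul_comm]
  rw [mem_degreeLT]
  have := degree_sub_lt_left (p := (1 - X ^ 2 : ℝ[X]) ^ (a + 1))
    (q := C ((-1) ^ (a + 1)) * X ^ (2 * (a + 1))) (by
      rw [hd, degree_C_mul_X_pow _ (pow_ne_zero _ (by norm_num))])
    (pow_ne_zero _ hne) (by
      rw [leadingCoeff_pow, hl, leadingCoeff_C_mul_X_pow])
  rwa [hd] at this

/-- The conditional expectation of `x_i ^ k` given `x_j` is a polynomial in `x_j`, of degree at
most `k`, whose coefficient of degree `k` is at most `1 / m` if `k ≠ 0`. -/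
theorem exists_coordCorr_X_pow (m k : ℕ) (hm : 0 < m) {i j : Fin (m + 1)} (hij : i ≠ j) :
    ∃ (c : ℝ) (T : ℝ[X]), (k ≠ 0 → |c| ≤ 1 / (m : ℝ)) ∧ T - C c * X ^ k ∈ degreeLT ℝ k ∧
      ∀ q, coordCorr m i j (X ^ k) q = coordCorr m j j T q := by
  have ext : ∀ T : ℝ[X], (∀ l : ℕ, coordCorr m i j (X ^ k) (X ^ l) = coordCorr m j j T (X ^ l)) →
      ∀ q, coordCorr m i j (X ^ k) q = coordCorr m j j T q := by
    intro T h q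
    refine LinearMap.congr_fun ((basisMonomials ℝ).ext fun l ↦ ?_) q
    simpa [monomial_one_right_eq_X_pow] using h l
  obtain ⟨a, rfl | rfl⟩ := Nat.even_or_odd' k
  · rcases a with _ | a
    · exact ⟨1, 1, by simp, by simp, ext _ fun l ↦ by simp [coordCorr_apply]⟩
    · obtain ⟨c, hc, h⟩ := exists_integral_sphereUniform_even_pow_mul m a hm hij
      -- The sign is the leading coefficient of (1 - X²)^(a+1).
      refine ⟨c * (-1) ^ (a + 1), c • (1 - X ^ 2) ^ (a + 1), fun _ ↦ by simpa [abs_mul] using hc,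
        ?_, ext _ fun l ↦ ?_⟩
      · have := Submodule.smul_mem _ c (one_sub_X_sq_pow_sub_mem_degreeLT a)
        rwa [smul_sub, smul_eq_C_mul, smul_eq_C_mul, ← mul_assoc, ← C_mul,
          ← smul_eq_C_mul c] at this
      · simpa [coordCorr_apply, mul_assoc, integral_const_mul] using h l
  · refine ⟨0, 0, by simp, by simp, ext _ fun l ↦ ?_⟩
    simpa [coordCorr_apply] using integral_sphereUniform_odd_pow_mul m a l hij

/-- Subtract from x_i^k its L² projection onto the finite-dimensional space of polynomials of lower
degree. Projecting in L² avoids having to show that the form is definite on polynomials. -/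
theorem exists_monic_orthogonal (m : ℕ) (i : Fin (m + 1)) (k : ℕ) :
    ∃ p : ℝ[X], p - X ^ k ∈ degreeLT ℝ k ∧ ∀ r ∈ degreeLT ℝ k, coordCorr m i i p r = 0 := by
  have hint : ∀ p : ℝ[X], MemLp (fun x : UnitSphere m ↦
      p.eval ((x : EuclideanSpace ℝ (Fin (m + 1))) i)) 2 (sphereUniform m) := fun p ↦
    Continuous.memLp_of_hasCompactSupport (by fun_prop) (.of_compactSpace _)
  let Φ : ℝ[X] →ₗ[ℝ] Lp ℝ 2 (sphereUniform m) :=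
    { toFun := fun p ↦ (hint p).toLp
      map_add' := fun p q ↦ by
        rw [← MemLp.toLp_add]; congr 1; ext x; simp
      map_smul' := fun c p ↦ by
        rw [RingHom.id_apply, ← MemLp.toLp_const_smul]; congr 1; ext x; simp }
  have hΦ : ∀ p q, inner ℝ (Φ q) (Φ p) = coordCorr m i i p q := by
    intro p q
    rw [L2.inner_def, coordCorr_apply]
    refine integral_congr_ae ?_
    filter_upwards [(hint p).coeFn_toLp, (hint q).coeFn_toLp] with x hp hq
    simp [Φ, hp, hq]
  let V := (degreeLT ℝ k).map Φ
  have : FiniteDimensional ℝ (degreeLT ℝ k) :=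
    Module.Finite.equiv (degreeLTEquiv ℝ k).symm
  have : FiniteDimensional ℝ V := inferInstance
  obtain ⟨q, hq, hqv⟩ : V.starProjection (Φ (X ^ k)) ∈ V := Submodule.starProjection_apply_mem _ _
  refine ⟨X ^ k - q, by simpa using hq, fun r hr ↦ ?_⟩
  rw [← hΦ, map_sub, hqv]
  exact (Submodule.mem_orthogonal _ _).1 (V.sub_starProjection_mem_orthogonal (Φ (X ^ k))) _
    (Submodule.mem_map_of_mem hr)

/-- A system of monic orthogonal polynomials for the law of one coordinate, which also
diagonalises the correlation of two coordinates. -/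
structure IsCoordEigenSystem (m : ℕ) (i j : Fin (m + 1)) (p : ℕ → ℝ[X]) (c N : ℕ → ℝ) : Prop where
  zero : p 0 = 1
  span : ∀ q, q ∈ Submodule.span ℝ (Set.range p)
  nonneg : ∀ k, 0 ≤ N k
  le : ∀ k, k ≠ 0 → |c k| ≤ 1 / (m : ℝ)
  left : ∀ k l, coordCorr m i i (p k) (p l) = if k = l then N k else 0
  right : ∀ k l, coordCorr m j j (p k) (p l) = if k = l then N k else 0
  corr : ∀ k l, coordCorr m i j (p k) (p l) = if k = l then c k * N k else 0

theorem exists_isCoordEigenSystem (m : ℕ) (hm : 0 < m) {i j : Fin (m + 1)} (hij : i ≠ j) :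
    ∃ p c N, IsCoordEigenSystem m i j p c N := by
  choose p hp horth using exists_monic_orthogonal m j
  choose c T hc hT hcorr using fun k ↦ exists_coordCorr_X_pow m k hm hij
  have hp0 : p 0 = 1 := by
    have := hp 0
    rw [mem_degreeLT] at this
    simpa [sub_eq_zero] using this
  have hlt : ∀ {k l}, k < l → degreeLT ℝ k ≤ degreeLT ℝ l := fun h ↦ degreeLT_mono h.le
  have hX : ∀ {k l}, k < l → (X ^ k : ℝ[X]) ∈ degreeLT ℝ l := fun {k l} h ↦ by
    rw [mem_degreeLT, degree_X_pow]; exact_mod_cast h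
  have hpm : ∀ {k l}, k < l → p k ∈ degreeLT ℝ l := fun {k l} h ↦ by
    have := Submodule.add_mem _ (hlt h (hp k)) (hX h)
    simpa using this
  have hTm : ∀ {k l}, k < l → T k ∈ degreeLT ℝ l := fun {k l} h ↦ by
    have := Submodule.add_mem _ (hlt h (hT k)) (Submodule.smul_mem _ (c k) (hX h))
    simpa [smul_eq_C_mul] using this
  have hsymm : ∀ q r, coordCorr m j j q r = coordCorr m j j r q := coordCorr_comm m j j
  have hdiag : ∀ k l, coordCorr m j j (p k) (p l) =
      if k = l then coordCorr m j j (p k) (p k) else 0 := by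
    intro k l
    split_ifs with h
    · rw [h]
    · rcases lt_or_gt_of_ne h with h | h
      · rw [hsymm, horth l _ (hpm h)]
      · exact horth k _ (hpm h)
  -- Conditioning does not raise the degree, so the result stays orthogonal to `p k`.
  have hlow : ∀ k, ∀ r ∈ degreeLT ℝ k, coordCorr m i j r (p k) = 0 := by
    intro k r hr
    have : degreeLT ℝ k ≤ LinearMap.ker ((coordCorr m i j).flip (p k)) := by
      rw [degreeLT_eq_span_X_pow, Submodule.span_le]
      intro q hq
      obtain ⟨l, hl, rfl⟩ := Finset.mem_image.1 (Finset.mem_coe.1 hq)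
      rw [SetLike.mem_coe, LinearMap.mem_ker, LinearMap.flip_apply, hcorr, hsymm]
      exact horth k _ (hTm (Finset.mem_range.1 hl))
    exact LinearMap.mem_ker.1 (this hr)
  refine ⟨p, c, fun k ↦ coordCorr m j j (p k) (p k), hp0, ?_, ?_, hc, ?_, hdiag, ?_⟩
  · have : ∀ k, degreeLT ℝ k ≤ Submodule.span ℝ (Set.range p) := by
      intro k
      induction k with
      | zero => intro q hq; rw [mem_degreeLT] at hq; simp_all
      | succ k ih =>
        rw [degreeLT_eq_span_X_pow, Submodule.span_le]
        intro q hq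
        obtain ⟨l, hl, rfl⟩ := Finset.mem_image.1 (Finset.mem_coe.1 hq)
        rcases (Nat.lt_succ_iff.1 (Finset.mem_range.1 hl)).lt_or_eq with h | rfl
        · exact ih (hX h)
        · have := Submodule.sub_mem _ (Submodule.subset_span (s := Set.range p) ⟨l, rfl⟩) (ih (hp l))
          simpa using this
    intro q
    exact this (q.natDegree + 1) (mem_degreeLT.2 ((degree_le_natDegree).trans_lt
      (by exact_mod_cast Nat.lt_succ_self _)))
  · intro k
    rw [coordCorr_apply]
    exact integral_nonneg fun x ↦ mul_self_nonneg _
  · rw [coordCorr_self_eq m i j]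
    exact hdiag
  · intro k l
    split_ifs with h
    · subst h
      -- Against `p k` only the degree k term survives, before and after conditioning; the
      -- eigenvalue is therefore `c k`.
      have h1 : coordCorr m i j (p k) (p k) = coordCorr m i j (X ^ k) (p k) := by
        have := hlow k _ (hp k)
        rwa [map_sub, LinearMap.sub_apply, sub_eq_zero] at this
      have h2 : coordCorr m j j (p k) (p k) = coordCorr m j j (X ^ k) (p k) := by
        have := horth k _ (hp k)
        rw [hsymm] at this
        rwa [map_sub, LinearMap.sub_apply, sub_eq_zero] at this
      have h3 : coordCorr m j j (T k) (p k) = coordCorr m j j (C (c k) * X ^ k) (p k) := by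
        have := horth k _ (hT k)
        rw [hsymm] at this
        rwa [map_sub, LinearMap.sub_apply, sub_eq_zero] at this
      rw [h1, hcorr, h3, ← smul_eq_C_mul, map_smul, LinearMap.smul_apply, smul_eq_mul, h2]
    · rcases lt_or_gt_of_ne h with h | h
      · exact hlow l _ (hpm h)
      · rw [coordCorr_comm, coordCorr_swap]
        exact hlow k _ (hpm h)

end OrthogonalPolynomials

/-! ### Maximal correlation of two diagonally correlated orthogonal systems -/

section Hilbert

variable {H ι : Type*} [NormedAddCommGroup H] [InnerProductSpace ℂ H]

theorem norm_sum_smul_sq_of_orthogonal [DecidableEq ι] {e : ι → H} {N : ι → ℝ}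
    (he : ∀ a b, inner ℂ (e a) (e b) = if a = b then (N a : ℂ) else 0) (s : Finset ι) (x : ι → ℂ) :
    ‖∑ a ∈ s, x a • e a‖ ^ 2 = ∑ a ∈ s, ‖x a‖ ^ 2 * N a := by
  have : (‖∑ a ∈ s, x a • e a‖ ^ 2 : ℂ) = ∑ a ∈ s, (‖x a‖ ^ 2 : ℂ) * N a := by
    rw [← Complex.coe_algebraMap, ← inner_self_eq_norm_sq_to_K (𝕜 := ℂ)]
    simp only [sum_inner, inner_sum, inner_smul_left, inner_smul_right, he]
    refine Finset.sum_congr rfl fun a ha ↦ ?_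
    simp only [mul_ite, mul_zero, Finset.sum_ite_eq', ha, if_true]
    rw [← mul_assoc, Complex.mul_conj']
    simp
  exact_mod_cast this

theorem exists_finset_sum_of_mem_span_range {e : ι → H} {g : H}
    (hg : g ∈ Submodule.span ℂ (Set.range e)) :
    ∃ (s : Finset ι) (x : ι → ℂ), ∀ t, s ⊆ t → g = ∑ a ∈ t, x a • e a := by
  obtain ⟨x, rfl⟩ := Finsupp.mem_span_range_iff_exists_finsupp.1 hg
  refine ⟨x.support, x, fun t ht ↦ ?_⟩
  exact Finset.sum_subset ht fun a _ ha ↦ by simp [Finsupp.notMem_support_iff.1 ha]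

/-- Two orthogonal systems which are diagonally correlated, with correlation coefficients at most
`κ` outside of one common vector, have maximal correlation at most `κ` orthogonally to it. -/
theorem norm_inner_le_of_diagonal_correlation [DecidableEq ι] {e e' : ι → H} {c N : ι → ℝ} {κ : ℝ} {i₀ : ι}
    (hN : ∀ a, 0 ≤ N a)
    (he : ∀ a b, inner ℂ (e a) (e b) = if a = b then (N a : ℂ) else 0)
    (he' : ∀ a b, inner ℂ (e' a) (e' b) = if a = b then (N a : ℂ) else 0)
    (hee' : ∀ a b, inner ℂ (e a) (e' b) = if a = b then (c a * N a : ℂ) else 0)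
    (h₀ : e i₀ = e' i₀) (hc : ∀ a ≠ i₀, |c a| ≤ κ) (hκ : 0 ≤ κ) (h₁ : N i₀ = 1)
    {g h : H} (hg : g ∈ (Submodule.span ℂ (Set.range e)).topologicalClosure)
    (hh : h ∈ (Submodule.span ℂ (Set.range e')).topologicalClosure)
    (hg₀ : inner ℂ g (e i₀) = 0) :
    ‖inner ℂ g h‖ ≤ κ * (‖g‖ * ‖h‖) := by
  have hc₀ : (c i₀ : ℂ) = 1 := by
    have h1 := hee' i₀ i₀
    rw [← h₀, he] at h1
    simpa [h₁] using h1.symm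
  -- Approximants of g in the span need not be orthogonal to `e i₀`. Subtracting the `i₀` component
  -- gives a closed condition valid on the whole span, which then passes to the closures one
  -- variable at a time.
  have key : ∀ g ∈ Submodule.span ℂ (Set.range e), ∀ h ∈ Submodule.span ℂ (Set.range e'),
      ‖inner ℂ g h - inner ℂ g (e i₀) * inner ℂ (e i₀) h‖ ≤ κ * (‖g‖ * ‖h‖) := by
    intro g hg h hh
    obtain ⟨s, x, hs⟩ := exists_finset_sum_of_mem_span_range hg
    obtain ⟨s', y, hs'⟩ := exists_finset_sum_of_mem_span_range hh
    set t := insert i₀ (s ∪ s')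
    have hst : s ⊆ t := Finset.subset_union_left.trans (Finset.subset_insert _ _)
    have hst' : s' ⊆ t := Finset.subset_union_right.trans (Finset.subset_insert _ _)
    have hit : i₀ ∈ t := Finset.mem_insert_self _ _
    have hgn := norm_sum_smul_sq_of_orthogonal he t x
    have hhn := norm_sum_smul_sq_of_orthogonal he' t y
    rw [← hs t hst] at hgn
    rw [← hs' t hst'] at hhn
    have hD : inner ℂ g h - inner ℂ g (e i₀) * inner ℂ (e i₀) h =
        ∑ a ∈ t.erase i₀, (starRingEnd ℂ) (x a) * y a * (c a * N a) := by
      have h1 : inner ℂ g h = ∑ a ∈ t, (starRingEnd ℂ) (x a) * y a * (c a * N a) := by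
        rw [hs t hst, hs' t hst']
        simp only [sum_inner, inner_sum, inner_smul_left, inner_smul_right, hee']
        refine Finset.sum_congr rfl fun a ha ↦ ?_
        simp only [mul_ite, mul_zero, Finset.sum_ite_eq', ha, if_true]
        ring
      have h2 : inner ℂ g (e i₀) = (starRingEnd ℂ) (x i₀) := by
        rw [hs t hst]
        simp [he, h₁, hit]
      have h3 : inner ℂ (e i₀) h = y i₀ := by
        rw [h₀, hs' t hst']
        simp [he', h₁, hit]
      rw [h1, h2, h3, ← Finset.add_sum_erase t _ hit, hc₀, h₁]
      simp
    rw [hD]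
    calc _ ≤ ∑ a ∈ t.erase i₀, κ * ((‖x a‖ * √(N a)) * (‖y a‖ * √(N a))) := by
          refine norm_sum_le_of_le _ fun a ha ↦ ?_
          rw [mul_mul_mul_comm ‖x a‖, Real.mul_self_sqrt (hN a)]
          simp only [norm_mul, RCLike.norm_conj, Complex.norm_real, Real.norm_eq_abs,
            abs_of_nonneg (hN a)]
          rw [mul_left_comm]
          have := hc a (Finset.ne_of_mem_erase ha)
          have := hN a
          gcongr
      _ ≤ ∑ a ∈ t, κ * ((‖x a‖ * √(N a)) * (‖y a‖ * √(N a))) :=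
          Finset.sum_le_sum_of_subset_of_nonneg (Finset.erase_subset _ _)
            fun a _ _ ↦ by positivity
      _ ≤ κ * (‖g‖ * ‖h‖) := by
          rw [← Finset.mul_sum]
          gcongr
          refine (Real.sum_mul_le_sqrt_mul_sqrt _ _ _).trans_eq ?_
          simp only [mul_pow, Real.sq_sqrt (hN _)]
          rw [← hgn, ← hhn, Real.sqrt_sq (norm_nonneg _), Real.sqrt_sq (norm_nonneg _)]
  have key' : ∀ h ∈ Submodule.span ℂ (Set.range e'),
      ‖inner ℂ g h - inner ℂ g (e i₀) * inner ℂ (e i₀) h‖ ≤ κ * (‖g‖ * ‖h‖) := by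
    intro h hh
    refine closure_minimal (s := (Submodule.span ℂ (Set.range e) : Set H))
      (t := {g | ‖inner ℂ g h - inner ℂ g (e i₀) * inner ℂ (e i₀) h‖ ≤ κ * (‖g‖ * ‖h‖)})
      (fun g hg ↦ key g hg h hh) (isClosed_le (by fun_prop) (by fun_prop)) hg
  have := closure_minimal (s := (Submodule.span ℂ (Set.range e') : Set H))
      (t := {h | ‖inner ℂ g h - inner ℂ g (e i₀) * inner ℂ (e i₀) h‖ ≤ κ * (‖g‖ * ‖h‖)})
      key' (isClosed_le (by fun_prop) (by fun_prop)) hh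
  simpa [hg₀] using this

end Hilbert

/-! ### Products of polynomials in the heights of n points, and their density -/

section Products

open Polynomial

/-- The map `x ↦ (x_1 i, …, x_n i)` from `(S^m)^n` to the cube `[-1, 1]^n`. -/
def cubeHeights (m n : ℕ) (i : Fin (m + 1)) :
    C(Fin n → UnitSphere m, Fin n → Set.Icc (-1 : ℝ) 1) where
  toFun x t := ⟨(x t : EuclideanSpace ℝ (Fin (m + 1))) i, by
    have h := PiLp.norm_apply_le (x t : EuclideanSpace ℝ (Fin (m + 1))) i
    rw [norm_eq_of_mem_sphere, Real.norm_eq_abs] at h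
    exact abs_le.1 h⟩
  continuous_toFun := by fun_prop

/-- The function `y ↦ ∏ t, q t (y t)` on the cube `[-1, 1]^n`. -/
noncomputable def cubeProd {n : ℕ} (q : Fin n → ℝ[X]) : C(Fin n → Set.Icc (-1 : ℝ) 1, ℂ) where
  toFun y := ∏ t, (((q t).eval (y t : ℝ) : ℝ) : ℂ)
  continuous_toFun := by fun_prop

/-- `cubeProd` is multilinear: expand each factor in the system p and multiply out. -/
theorem cubeProd_mem_span {n : ℕ} {p : ℕ → ℝ[X]}
    (hp : ∀ q, q ∈ Submodule.span ℝ (Set.range p)) (q : Fin n → ℝ[X]) :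
    cubeProd q ∈ Submodule.span ℂ (Set.range fun α : Fin n → ℕ ↦ cubeProd fun t ↦ p (α t)) := by
  choose x hx using fun t ↦ Finsupp.mem_span_range_iff_exists_finsupp.1 (hp (q t))
  have : cubeProd q = ∑ α ∈ Fintype.piFinset fun t ↦ (x t).support,
      (∏ t, (x t (α t) : ℂ)) • cubeProd fun t ↦ p (α t) := by
    ext y
    simp only [cubeProd, ContinuousMap.coe_mk, ContinuousMap.coe_sum, Finset.sum_apply,
      ContinuousMap.coe_smul, Pi.smul_apply, smul_eq_mul, ← Finset.prod_mul_distrib]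
    rw [← Finset.prod_univ_sum (fun t ↦ (x t).support)
      (fun t k ↦ (x t k : ℂ) * (((p k).eval (y t : ℝ) : ℝ) : ℂ))]
    refine Finset.prod_congr rfl fun t _ ↦ ?_
    rw [← hx t, Finsupp.sum, eval_finsetSum]
    push_cast
    simp
  rw [this]
  exact Submodule.sum_mem _ fun α _ ↦ Submodule.smul_mem _ _ (Submodule.subset_span ⟨α, rfl⟩)

/-- Stone–Weierstrass on the cube: the coordinates are real-valued and separate points, and the
algebra they generate is spanned by monomials, which are instances of `cubeProd`. -/
theorem cubeProd_span_topologicalClosure {n : ℕ} {p : ℕ → ℝ[X]}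
    (hp : ∀ q, q ∈ Submodule.span ℝ (Set.range p)) :
    (Submodule.span ℂ (Set.range fun α : Fin n → ℕ ↦
      cubeProd fun t ↦ p (α t))).topologicalClosure = ⊤ := by
  let coord : Fin n → C(Fin n → Set.Icc (-1 : ℝ) 1, ℂ) := fun t ↦
    ⟨fun y ↦ ((y t : ℝ) : ℂ), by fun_prop⟩
  let A := StarAlgebra.adjoin ℂ (Set.range coord)
  have hA : A.topologicalClosure = ⊤ := by
    refine ContinuousMap.starSubalgebra_topologicalClosure_eq_top_of_separatesPoints _ ?_
    intro x y hxy
    obtain ⟨t, ht⟩ := Function.ne_iff.1 hxy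
    refine ⟨_, ⟨coord t, StarAlgebra.subset_adjoin ℂ _ ⟨t, rfl⟩, rfl⟩, ?_⟩
    simpa [coord, Subtype.ext_iff] using ht
  have hle : A.toSubalgebra.toSubmodule ≤ Submodule.span ℂ (Set.range fun α : Fin n → ℕ ↦
      cubeProd fun t ↦ p (α t)) := by
    have hstar : star (Set.range coord) = Set.range coord := by
      ext f
      have h : ∀ t, star (coord t) = coord t := fun t ↦ by ext y; simp [coord]
      constructor
      · rintro ⟨t, ht⟩
        exact ⟨t, by rw [← h t, ht, star_star]⟩
      · rintro ⟨t, rfl⟩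
        exact ⟨t, (h t).symm⟩
    rw [StarAlgebra.adjoin_toSubalgebra, hstar, Set.union_self, Algebra.adjoin_eq_span,
      Submodule.span_le]
    intro f hf
    suffices ∃ β : Fin n → ℕ, f = cubeProd fun t ↦ X ^ β t by
      obtain ⟨β, rfl⟩ := this
      exact cubeProd_mem_span hp _
    induction hf using Submonoid.closure_induction with
    | mem f hf =>
      obtain ⟨t, rfl⟩ := hf
      refine ⟨Pi.single t 1, ?_⟩
      ext y
      simp only [cubeProd, coord, ContinuousMap.coe_mk]
      rw [Finset.prod_eq_single t] <;> simp +contextual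
    | one => exact ⟨0, by ext y; simp [cubeProd]⟩
    | mul f g _ _ hf hg =>
      obtain ⟨β, rfl⟩ := hf
      obtain ⟨γ, rfl⟩ := hg
      exact ⟨β + γ, by ext y; simp [cubeProd, pow_add, Finset.prod_mul_distrib]⟩
  rw [eq_top_iff]
  have h2 := Submodule.topologicalClosure_mono hle
  refine le_trans (fun f _ ↦ ?_) h2
  have : f ∈ A.topologicalClosure := by rw [hA]; trivial
  exact this

/-- The product `x ↦ ∏ t, q t (x_t i)` as an element of `L²((S^m)^n)`. -/
noncomputable def heightProdLp (m n : ℕ) (i : Fin (m + 1)) (q : Fin n → ℝ[X]) :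
    Lp ℂ 2 (spherePowUniform m n) :=
  ContinuousMap.toLp (E := ℂ) 2 (spherePowUniform m n) ℂ ((cubeProd q).comp (cubeHeights m n i))

theorem inner_heightProdLp (m n : ℕ) (i j : Fin (m + 1)) (q r : Fin n → ℝ[X]) :
    inner ℂ (heightProdLp m n i q) (heightProdLp m n j r) =
      ((∏ t, coordCorr m i j (q t) (r t) : ℝ) : ℂ) := by
  rw [heightProdLp, heightProdLp, ContinuousMap.inner_toLp]
  simp only [coordCorr_apply]
  rw [← integral_fintype_prod_eq_prod, spherePowUniform,
    ← integral_complex_ofReal]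
  refine integral_congr_ae (.of_forall fun x ↦ ?_)
  simp [cubeProd, cubeHeights, Finset.prod_mul_distrib, mul_comm]

/-- A function of the heights is a pullback from the cube, and pullback is an L² isometry for the
image measure. On the cube, continuous functions are dense in L², and the polynomial products are
uniformly dense among them. -/
theorem mem_closure_span_heightProdLp (m n : ℕ) (i : Fin (m + 1)) {p : ℕ → ℝ[X]}
    (hp : ∀ q, q ∈ Submodule.span ℝ (Set.range p)) {g : (Fin n → UnitSphere m) → ℂ}
    (hg : MemLp g 2 (spherePowUniform m n)) (hgm : StronglyMeasurable[heightSigma m n i] g) :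
    hg.toLp ∈ (Submodule.span ℂ (Set.range fun α : Fin n → ℕ ↦
      heightProdLp m n i fun t ↦ p (α t))).topologicalClosure := by
  obtain ⟨ψ, hψm, hψ⟩ := hgm.exists_eq_measurable_comp
  set μ := spherePowUniform m n
  have hT : MeasurePreserving (cubeHeights m n i) μ (μ.map (cubeHeights m n i)) :=
    (cubeHeights m n i).continuous.measurable.measurePreserving μ
  set ν := μ.map (cubeHeights m n i)
  have : IsFiniteMeasure ν := Measure.isFiniteMeasure_map _ _
  let φ : (Fin n → Set.Icc (-1 : ℝ) 1) → ℂ := fun y ↦ ψ fun t ↦ (y t : ℝ)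
  have hφm : StronglyMeasurable φ := hψm.comp_measurable (by fun_prop)
  have hgφ : g = φ ∘ cubeHeights m n i := hψ
  have hφ : MemLp φ 2 ν := by
    rw [memLp_map_measure_iff hφm.aestronglyMeasurable hT.measurable.aemeasurable, ← hgφ]
    exact hg
  let J : Lp ℂ 2 ν →ₗᵢ[ℂ] Lp ℂ 2 μ := Lp.compMeasurePreservingₗᵢ ℂ (cubeHeights m n i) hT
  have hJ : J hφ.toLp = hg.toLp := by
    change Lp.compMeasurePreserving _ hT _ = _
    rw [Lp.toLp_compMeasurePreserving]
    simp only [hgφ]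
  have hdense := (ContinuousMap.toLp_denseRange ℂ ν ℂ
    (p := 2) (by norm_num)).topologicalClosure_map_submodule
      (cubeProd_span_topologicalClosure (n := n) hp)
  have hmem : hφ.toLp ∈ ((Submodule.span ℂ (Set.range fun α : Fin n → ℕ ↦
      cubeProd fun t ↦ p (α t))).map
        (ContinuousMap.toLp (E := ℂ) 2 ν ℂ).toLinearMap).topologicalClosure := by
    rw [hdense]; trivial
  rw [← hJ]
  refine map_mem_closure J.continuous hmem ?_
  intro f hf
  obtain ⟨u, hu, rfl⟩ := hf
  have hJu : ∀ u : C(Fin n → Set.Icc (-1 : ℝ) 1, ℂ), J (ContinuousMap.toLp (E := ℂ) 2 ν ℂ u) =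
      ContinuousMap.toLp (E := ℂ) 2 μ ℂ (u.comp (cubeHeights m n i)) := by
    intro u
    refine Lp.ext ?_
    have h1 := Lp.coeFn_compMeasurePreserving (ContinuousMap.toLp (E := ℂ) 2 ν ℂ u) hT
    have h2 := hT.quasiMeasurePreserving.ae_eq_comp (ContinuousMap.coeFn_toLp (p := 2) ν (𝕜 := ℂ) u)
    have h3 := ContinuousMap.coeFn_toLp (p := 2) μ (𝕜 := ℂ) (u.comp (cubeHeights m n i))
    exact (h1.trans h2).trans h3.symm
  have hmap : Submodule.span ℂ (Set.range fun α : Fin n → ℕ ↦ cubeProd fun t ↦ p (α t)) ≤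
      (Submodule.span ℂ (Set.range fun α : Fin n → ℕ ↦
        heightProdLp m n i fun t ↦ p (α t))).comap
        (J.toLinearMap ∘ₗ (ContinuousMap.toLp (E := ℂ) 2 ν ℂ).toLinearMap) := by
    rw [Submodule.span_le]
    rintro _ ⟨α, rfl⟩
    refine Submodule.subset_span ⟨α, ?_⟩
    exact (hJu _).symm
  exact hmap hu

end Products

/-! ### The correlation bound for n points and the conclusion -/

theorem abs_prod_le_of_ne_zero {n : ℕ} {c : ℕ → ℝ} {κ : ℝ} (hκ : κ ≤ 1) (h0 : c 0 = 1)
    (hc : ∀ k, k ≠ 0 → |c k| ≤ κ) {α : Fin n → ℕ} (hα : α ≠ 0) : |∏ t, c (α t)| ≤ κ := by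
  obtain ⟨t, ht⟩ := Function.ne_iff.1 hα
  have h1 : ∀ k, |c k| ≤ 1 := fun k ↦ by
    rcases eq_or_ne k 0 with rfl | hk
    · simp [h0]
    · exact (hc k hk).trans hκ
  rw [← Finset.mul_prod_erase _ _ (Finset.mem_univ t), abs_mul, Finset.abs_prod]
  calc _ ≤ |c (α t)| * 1 := by
        gcongr
        exact Finset.prod_le_one (fun _ _ ↦ abs_nonneg _) fun _ _ ↦ h1 _
    _ ≤ κ := by rw [mul_one]; exact hc _ ht

/-- The heights in two different directions have maximal correlation at most `1 / m`. -/
theorem norm_inner_toLp_le (m n : ℕ) (hm : 0 < m) {i j : Fin (m + 1)} (hij : i ≠ j)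
    {g h : (Fin n → UnitSphere m) → ℂ}
    (hg : MemLp g 2 (spherePowUniform m n)) (hgm : StronglyMeasurable[heightSigma m n i] g)
    (hh : MemLp h 2 (spherePowUniform m n)) (hhm : StronglyMeasurable[heightSigma m n j] h)
    (hg0 : ∫ x, g x ∂(spherePowUniform m n) = 0) :
    ‖inner ℂ hg.toLp hh.toLp‖ ≤ 1 / (m : ℝ) * (‖hg.toLp‖ * ‖hh.toLp‖) := by
  obtain ⟨p, c, N, hs⟩ := exists_isCoordEigenSystem m hm hij
  have hN0 : N 0 = 1 := by
    have := hs.left 0 0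
    simpa [hs.zero, coordCorr_apply] using this.symm
  have hc0 : c 0 = 1 := by
    have := hs.corr 0 0
    simpa [hs.zero, coordCorr_apply, hN0] using this.symm
  have hm1 : 1 / (m : ℝ) ≤ 1 := by
    rw [div_le_one (by positivity)]
    exact_mod_cast hm
  have hprod : ∀ (f : ℕ → ℝ) (α β : Fin n → ℕ),
      ((∏ t, (if α t = β t then f (α t) else 0) : ℝ) : ℂ) =
        if α = β then ((∏ t, f (α t) : ℝ) : ℂ) else 0 := by
    intro f α β
    split_ifs with h
    · simp [h]
    · obtain ⟨t, ht⟩ := Function.ne_iff.1 h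
      rw [Finset.prod_eq_zero (Finset.mem_univ t) (if_neg ht), Complex.ofReal_zero]
  let e : Fin (m + 1) → (Fin n → ℕ) → Lp ℂ 2 (spherePowUniform m n) := fun i α ↦
    heightProdLp m n i fun t ↦ p (α t)
  have hone : ∀ i : Fin (m + 1), e i 0 =
      ContinuousMap.toLp (E := ℂ) 2 (spherePowUniform m n) ℂ 1 := by
    intro i
    simp only [e, heightProdLp]
    congr 1
    ext x
    simp [cubeProd, hs.zero]
  have he : ∀ α β, inner ℂ (e i α) (e i β) = if α = β then ((∏ t, N (α t) : ℝ) : ℂ) else 0 := by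
    intro α β
    simp only [e, inner_heightProdLp, hs.left, hprod]
  have he' : ∀ α β, inner ℂ (e j α) (e j β) = if α = β then ((∏ t, N (α t) : ℝ) : ℂ) else 0 := by
    intro α β
    simp only [e, inner_heightProdLp, hs.right, hprod]
  have hee' : ∀ α β, inner ℂ (e i α) (e j β) =
      if α = β then ((∏ t, c (α t) : ℝ) : ℂ) * ((∏ t, N (α t) : ℝ) : ℂ) else 0 := by
    intro α β
    simp only [e, inner_heightProdLp, hs.corr]
    rw [hprod (fun k ↦ c k * N k), Finset.prod_mul_distrib, Complex.ofReal_mul]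
  -- The index 0 gives the constant function 1, common to both systems, so this is the mean-zero
  -- hypothesis.
  have hg₀ : inner ℂ hg.toLp (e i 0) = 0 := by
    rw [hone, L2.inner_def, ← map_zero (starRingEnd ℂ), ← hg0, ← integral_conj]
    refine integral_congr_ae ?_
    filter_upwards [hg.coeFn_toLp, ContinuousMap.coeFn_toLp (p := 2) (spherePowUniform m n) (𝕜 := ℂ)
      (1 : C(Fin n → UnitSphere m, ℂ))] with x h1 h2
    rw [h1, h2]
    simp
  have hge := mem_closure_span_heightProdLp m n i hs.span hg hgm
  have hhe := mem_closure_span_heightProdLp m n j hs.span hh hhm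
  have hc : ∀ α : Fin n → ℕ, α ≠ 0 → |∏ t, c (α t)| ≤ 1 / (m : ℝ) := fun α hα ↦
    abs_prod_le_of_ne_zero hm1 hc0 hs.le hα
  have hN : ∏ t : Fin n, N ((0 : Fin n → ℕ) t) = 1 := by simp [hN0]
  exact norm_inner_le_of_diagonal_correlation (e := e i) (e' := e j) (i₀ := 0)
    (c := fun α ↦ ∏ t, c (α t)) (N := fun α ↦ ∏ t, N (α t))
    (fun α ↦ Finset.prod_nonneg fun t _ ↦ hs.nonneg _) he he' hee'
    ((hone i).trans (hone j).symm) hc (by positivity) hN hge hhe hg₀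

theorem mainTheorem8 (m n : ℕ) (hm : 2 ≤ m) (hn : 1 ≤ n)
    (f : (Fin n → UnitSphere m) → ℂ)
    (hf : MemLp f 2 (spherePowUniform m n))
    (hf0 : ∫ x, f x ∂(spherePowUniform m n) = 0) :
    eLpNorm (heightCondExp m n 1 (heightCondExp m n 0 f)) 2 (spherePowUniform m n) ≤
      ENNReal.ofReal (1 / (m : ℝ)) * eLpNorm f 2 (spherePowUniform m n) := by
  have h01 : (0 : Fin (m + 1)) ≠ 1 := by
    obtain ⟨k, rfl⟩ := Nat.exists_eq_add_of_le' (Nat.one_le_of_lt hm)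
    exact Fin.zero_ne_one
  set g := heightCondExp m n 0 f with hg_def
  set h := heightCondExp m n 1 g
  have hg : MemLp g 2 (spherePowUniform m n) := hf.condExp one_le_two
  have hh : MemLp h 2 (spherePowUniform m n) := hg.condExp one_le_two
  have hgf : eLpNorm g 2 (spherePowUniform m n) ≤ eLpNorm f 2 (spherePowUniform m n) :=
    eLpNorm_condExp_le_eLpNorm f one_le_two
  have hg0 : ∫ x, g x ∂(spherePowUniform m n) = 0 := by
    rw [hg_def, heightCondExp, integral_condExp (heightSigma_le m n 0), hf0]
  have hhm : StronglyMeasurable[heightSigma m n 1] h := stronglyMeasurable_condExp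
  have key := norm_inner_toLp_le m n (by omega) h01 hg stronglyMeasurable_condExp hh hhm hg0
  have hPg : condExpL2 ℂ ℂ (heightSigma_le m n 1) hg.toLp = hh.toLp :=
    Lp.ext ((hg.condExpL2_ae_eq_condExp (𝕜 := ℂ) (heightSigma_le m n 1)).trans hh.coeFn_toLp.symm)
  have hPh : condExpL2 ℂ ℂ (heightSigma_le m n 1) hh.toLp = hh.toLp := by
    refine Lp.ext ((hh.condExpL2_ae_eq_condExp (𝕜 := ℂ) (heightSigma_le m n 1)).trans ?_)
    rw [condExp_of_stronglyMeasurable (heightSigma_le m n 1) hhm (hh.integrable one_le_two)]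
    exact hh.coeFn_toLp.symm
  -- Conditional expectation is an orthogonal projection, with h the image of g. The correlation
  -- bound thus reads ‖h‖² ≤ (1/m) ‖g‖ ‖h‖, and one factor ‖h‖ can be cancelled.
  have hinner : inner ℂ hg.toLp hh.toLp = inner ℂ hh.toLp hh.toLp := by
    conv_lhs => rw [← hPh, ← inner_condExpL2_left_eq_right, hPg]
  rw [hinner, ← inner_self_re_eq_norm, inner_self_eq_norm_mul_norm, ← mul_assoc] at key
  have hle : ‖hh.toLp‖ ≤ 1 / (m : ℝ) * ‖hg.toLp‖ := by
    rcases (norm_nonneg hh.toLp).eq_or_lt with h0 | h0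
    · rw [← h0]; positivity
    · exact le_of_mul_le_mul_right key h0
  rw [Lp.norm_toLp, Lp.norm_toLp] at hle
  calc eLpNorm h 2 (spherePowUniform m n)
      = ENNReal.ofReal (eLpNorm h 2 (spherePowUniform m n)).toReal :=
        (ENNReal.ofReal_toReal hh.2.ne).symm
    _ ≤ ENNReal.ofReal (1 / (m : ℝ) * (eLpNorm g 2 (spherePowUniform m n)).toReal) :=
        ENNReal.ofReal_le_ofReal hle
    _ = ENNReal.ofReal (1 / (m : ℝ)) * eLpNorm g 2 (spherePowUniform m n) := by
        rw [ENNReal.ofReal_mul (by positivity), ENNReal.ofReal_toReal hg.2.ne]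
    _ ≤ _ := by gcongr
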